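/- Let $A$ be a finite dimensional $C^*$-algebra, $H$ a finite dimensional complex Hilbert space, and $t$ the transpose map on $B(H)$ with respect to a fixed orthonormal basis of $H$. A linear map $\psi\colon A\to B(H)$ is positive if it carries positive elements to positive operators, $k$-positive if the map $\iota_k\otimes\psi\colon M_k\otimes A\to M_k\otimes B(H)$ is positive (where $\iota_k$ is the identity map of the complex $k\times k$ matrices $M_k$), and completely positive if it is $k$-positive for all $k$; it is $k$-co-positive (resp. co-positive) if $t\circ\psi$ is $k$-positive (resp. completely positive). It is decomposable if it is the sum of a completely positive and a co-positive map, and $2$-decomposable if it is the sum of a $2$-positive and a $2$-co-positive map; it is atomic if it is not $2$-decomposable. Write $\psi\le\phi$, and say that $\phi$ majorizes $\psi$, if $\phi-\psi$ is positive. Let $\phi\colon A\to B(H)$ be a positive linear map. Then there are linear maps $\alpha,\beta\colon A\to B(H)$ with $\phi=\alpha+\beta$ such that (1) $\alpha$ is a maximal decomposable map majorized by $\phi$: $\alpha$ is decomposable, $\alpha\le\phi$, and there is no decomposable map $\psi\ne\alpha$ with $\alpha\le\psi\le\phi$; (2) $\beta$ is positive and bi-optimal: every completely positive map and every co-positive map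 majorized by $\beta$ is zero; (3) if $\beta\neq 0$, then $\beta$ is atomic. -/

import Mathlib

/-!
A nonzero `2`-positive map `φ` majorizes a nonzero completely positive map. Pick `η` with
`φ(1)η ≠ 0` and let `π` be the GNS representation of the functional `a ↦ ⟪η, φ(a)η⟫`. The
Cauchy-Schwarz inequality for `2`-positive maps makes `W : c ↦ φ(c)η` a bounded operator from the
GNS space to `H`, and applied once more it bounds `W π(y*y) W*` by `φ(y*y)`; moreover
`W(1) = φ(1)η ≠ 0`. Composing with the transpose gives the co-positive analogue, so a nonzero
bi-optimal map is atomic.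

The decomposable maps majorized by `φ` are compact for pointwise convergence, and one of them, `α`,
maximizes the trace of the value at `1`. A positive map whose value at `1` has trace zero vanishes,
so `α` is maximal, and by maximality `φ - α` majorizes no nonzero completely positive or co-positive
map.
-/

namespace PositiveMap

/-- The transpose map on `B(H)` with respect to the orthonormal basis `b` of `H`: the operator with
matrix `M` in the basis `b` is sent to the operator with matrix `Mᵀ` in the basis `b`. -/
noncomputable def transposeMap {H : Type*} [NormedAddCommGroup H] [InnerProductSpace ℂ H]
    [FiniteDimensional ℂ H] {ι : Type*} [Fintype ι] [DecidableEq ι]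
    (b : OrthonormalBasis ι ℂ H) : (H →L[ℂ] H) →ₗ[ℂ] (H →L[ℂ] H) where
  toFun x := LinearMap.toContinuousLinearMap
    (Matrix.toLin b.toBasis b.toBasis
      (LinearMap.toMatrix b.toBasis b.toBasis (x : H →ₗ[ℂ] H)).transpose)
  map_add' x y := by simp
  map_smul' c x := by simp

section

variable {A : Type*} [CStarAlgebra A] [PartialOrder A] [StarOrderedRing A]
variable {H : Type*} [NormedAddCommGroup H] [InnerProductSpace ℂ H] [CompleteSpace H]

/-- A linear map `φ : A → B(H)` is positive if it carries positive elements to positive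
operators. -/
def IsPositive (φ : A →ₗ[ℂ] (H →L[ℂ] H)) : Prop :=
  ∀ a : A, 0 ≤ a → 0 ≤ φ a

/-- `ψ` majorizes `φ`, i.e. `φ ≤ ψ`: the map `ψ - φ` is positive. -/
def Majorizes (ψ φ : A →ₗ[ℂ] (H →L[ℂ] H)) : Prop :=
  IsPositive (ψ - φ)

/-- `φ` is `k`-positive: applying `φ` entrywise carries positive elements of `M_k(A)` to positive
elements of `M_k(B(H))`. -/
def IsKPositive (k : ℕ) (φ : A →ₗ[ℂ] (H →L[ℂ] H)) : Prop :=
  ∀ M : CStarMatrix (Fin k) (Fin k) A, 0 ≤ M → 0 ≤ M.map φ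

/-- `φ` is completely positive: it is `k`-positive for all `k`. -/
def IsCompletelyPositive (φ : A →ₗ[ℂ] (H →L[ℂ] H)) : Prop :=
  ∀ k : ℕ, IsKPositive k φ

/-- `φ` is optimal: it majorizes no completely positive map except `0`. -/
def IsOptimal (φ : A →ₗ[ℂ] (H →L[ℂ] H)) : Prop :=
  ∀ ψ : A →ₗ[ℂ] (H →L[ℂ] H), IsCompletelyPositive ψ → Majorizes φ ψ → ψ = 0

end

section

variable {A : Type*} [CStarAlgebra A] [PartialOrder A] [StarOrderedRing A]
variable {H : Type*} [NormedAddCommGroup H] [InnerProductSpace ℂ H] [FiniteDimensional ℂ H]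
  [CompleteSpace H]
variable {ι : Type*} [Fintype ι] [DecidableEq ι]

/-- `φ` is `k`-co-positive: its composition with the transpose map is `k`-positive. -/
def IsKCopositive (b : OrthonormalBasis ι ℂ H) (k : ℕ) (φ : A →ₗ[ℂ] (H →L[ℂ] H)) : Prop :=
  IsKPositive k (transposeMap b ∘ₗ φ)

/-- `φ` is co-positive: its composition with the transpose map is completely positive. -/
def IsCopositive (b : OrthonormalBasis ι ℂ H) (φ : A →ₗ[ℂ] (H →L[ℂ] H)) : Prop :=
  IsCompletelyPositive (transposeMap b ∘ₗ φ)

/-- `φ` is `k`-decomposable: it is the sum of a `k`-positive and a `k`-co-positive map. -/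
def IsKDecomposable (b : OrthonormalBasis ι ℂ H) (k : ℕ) (φ : A →ₗ[ℂ] (H →L[ℂ] H)) : Prop :=
  ∃ φ₁ φ₂ : A →ₗ[ℂ] (H →L[ℂ] H), IsKPositive k φ₁ ∧ IsKCopositive b k φ₂ ∧ φ = φ₁ + φ₂

/-- `φ` is decomposable: it is the sum of a completely positive and a co-positive map. -/
def IsDecomposable (b : OrthonormalBasis ι ℂ H) (φ : A →ₗ[ℂ] (H →L[ℂ] H)) : Prop :=
  ∃ φ₁ φ₂ : A →ₗ[ℂ] (H →L[ℂ] H), IsCompletelyPositive φ₁ ∧ IsCopositive b φ₂ ∧ φ = φ₁ + φ₂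

/-- `φ` is atomic: it is not `2`-decomposable. -/
def IsAtomic (b : OrthonormalBasis ι ℂ H) (φ : A →ₗ[ℂ] (H →L[ℂ] H)) : Prop :=
  ¬ IsKDecomposable b 2 φ

/-- `φ` is co-optimal: it majorizes no co-positive map except `0`. -/
def IsCooptimal (b : OrthonormalBasis ι ℂ H) (φ : A →ₗ[ℂ] (H →L[ℂ] H)) : Prop :=
  ∀ ψ : A →ₗ[ℂ] (H →L[ℂ] H), IsCopositive b ψ → Majorizes φ ψ → ψ = 0

/-- `φ` is bi-optimal: it is both optimal and co-optimal. -/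
def IsBioptimal (b : OrthonormalBasis ι ℂ H) (φ : A →ₗ[ℂ] (H →L[ℂ] H)) : Prop :=
  IsOptimal φ ∧ IsCooptimal b φ

/-- `α` is a maximal decomposable map majorized by `φ`: it is decomposable, `α ≤ φ`, and there is
no decomposable map `ψ ≠ α` with `α ≤ ψ ≤ φ`. -/
def IsMaximalDecomposable (b : OrthonormalBasis ι ℂ H) (φ α : A →ₗ[ℂ] (H →L[ℂ] H)) : Prop :=
  IsDecomposable b α ∧ Majorizes φ α ∧
    ¬ ∃ ψ : A →ₗ[ℂ] (H →L[ℂ] H),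
      IsDecomposable b ψ ∧ ψ ≠ α ∧ Majorizes ψ α ∧ Majorizes φ ψ

end

end PositiveMap

namespace PositiveMap

open scoped InnerProductSpace ComplexOrder

section CStarAlgebra

variable {B : Type*} [CStarAlgebra B] [PartialOrder B] [StarOrderedRing B]

-- Instance search does not find the functional calculus that Mathlib's version asks for when the
-- algebra is a `CStarMatrix`.
theorem exists_eq_star_mul_self_of_nonneg {x : B} (hx : 0 ≤ x) : ∃ y, x = star y * y :=
  CStarAlgebra.nonneg_iff_eq_star_mul_self.1 hx

theorem map_nonneg_iff_of_injective {C : Type*} [CStarAlgebra C] [PartialOrder C]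
    [StarOrderedRing C] (π : B →⋆ₐ[ℂ] C) (hπ : Function.Injective π) {x : B} : 0 ≤ π x ↔ 0 ≤ x := by
  refine ⟨fun h => ?_, map_nonneg π⟩
  have hx : IsSelfAdjoint x := hπ <| by rw [map_star, (IsSelfAdjoint.of_nonneg h).star_eq]
  rw [StarOrderedRing.nonneg_iff_spectrum_nonneg (R := ℝ) _ hx, ← hx.map_spectrum_real π hπ]
  exact fun r hr => spectrum_nonneg_of_nonneg h hr

end CStarAlgebra

section OperatorMatrix

theorem nonneg_iff_forall_inner_nonneg {K : Type*} [NormedAddCommGroup K] [InnerProductSpace ℂ K]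
    {T : K →L[ℂ] K} : 0 ≤ T ↔ ∀ ξ, 0 ≤ ⟪ξ, T ξ⟫_ℂ := by
  rw [ContinuousLinearMap.nonneg_iff_isPositive]
  refine ⟨fun h => h.inner_nonneg_right, fun h => ?_⟩
  refine (ContinuousLinearMap.isPositive_iff_complex T).2 fun ξ => ?_
  have hξ : 0 ≤ ⟪T ξ, ξ⟫_ℂ := by
    rw [← inner_conj_symm]
    exact star_nonneg_iff.2 (h ξ)
  obtain ⟨hre, him⟩ := RCLike.nonneg_iff.1 hξ
  exact ⟨RCLike.conj_eq_iff_re.1 (RCLike.conj_eq_iff_im.2 him), hre⟩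

variable (n : Type*) [Fintype n] [DecidableEq n]
variable (H : Type*) [NormedAddCommGroup H] [InnerProductSpace ℂ H] [CompleteSpace H]

/-- The action of operator matrices on column vectors, identifying `M_n(B(H))` with `B(Hⁿ)`. -/
noncomputable def matrixAction :
    CStarMatrix n n (H →L[ℂ] H) →⋆ₐ[ℂ] (PiLp 2 (fun _ : n => H) →L[ℂ] PiLp 2 (fun _ : n => H)) where
  toFun M :=
    { toFun ξ := WithLp.toLp 2 fun i => ∑ j, M i j (ξ j)
      map_add' ξ ζ := by ext i; simp [Finset.sum_add_distrib]
      map_smul' c ξ := by ext i; simp [Finset.smul_sum]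
      cont := by fun_prop }
  map_one' := by
    ext ξ i
    simp [CStarMatrix.one_apply, apply_ite (DFunLike.coe : (H →L[ℂ] H) → H → H), ite_apply]
  map_mul' M N := by
    ext ξ i
    simp only [CStarMatrix.mul_apply, sum_apply, map_sum,
      mul_apply_eq_comp, ContinuousLinearMap.coe_mk', LinearMap.coe_mk, AddHom.coe_mk]
    exact Finset.sum_comm
  map_zero' := by ext ξ i; simp
  map_add' M N := by ext ξ i; simp [Finset.sum_add_distrib]
  commutes' c := by
    ext ξ i
    simp [CStarMatrix.algebraMap_apply, apply_ite (DFunLike.coe : (H →L[ℂ] H) → H → H), ite_apply]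
  map_star' M := by
    rw [ContinuousLinearMap.star_eq_adjoint, ContinuousLinearMap.eq_adjoint_iff]
    intro ξ ζ
    simp only [PiLp.inner_apply, CStarMatrix.star_apply, sum_inner, inner_sum,
      ContinuousLinearMap.coe_mk', LinearMap.coe_mk, AddHom.coe_mk,
      ContinuousLinearMap.star_eq_adjoint, ContinuousLinearMap.adjoint_inner_left]
    exact Finset.sum_comm

variable {n H}

theorem inner_matrixAction_apply (M : CStarMatrix n n (H →L[ℂ] H)) (ξ ζ : PiLp 2 fun _ : n => H) :
    ⟪ξ, matrixAction n H M ζ⟫_ℂ = ∑ i, ∑ j, ⟪ξ i, M i j (ζ j)⟫_ℂ := by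
  simp [matrixAction, PiLp.inner_apply, inner_sum]

theorem inner_single_matrixAction_single (M : CStarMatrix n n (H →L[ℂ] H)) (i j : n) (ξ ζ : H) :
    ⟪PiLp.single (β := fun _ : n => H) 2 i ξ,
      matrixAction n H M (PiLp.single (β := fun _ : n => H) 2 j ζ)⟫_ℂ = ⟪ξ, M i j ζ⟫_ℂ := by
  rw [inner_matrixAction_apply]
  rw [Finset.sum_eq_single_of_mem i (Finset.mem_univ i) fun i' _ h => by simp [h],
    Finset.sum_eq_single_of_mem j (Finset.mem_univ j) fun j' _ h => by simp [h]]
  simp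

theorem matrixAction_injective : Function.Injective (matrixAction n H) := by
  intro M N h
  ext i j ζ
  refine ext_inner_left ℂ fun ξ => ?_
  rw [← inner_single_matrixAction_single, h, inner_single_matrixAction_single]

end OperatorMatrix

section CStarMatrix

variable {n : Type*} [Fintype n]
variable {B : Type*} [CStarAlgebra B] [PartialOrder B] [StarOrderedRing B]

theorem cstarMatrix_star_mul_nonneg [Nonempty n] (v : n → B) :
    0 ≤ (CStarMatrix.ofMatrix (Matrix.of fun i j => star (v i) * v j) : CStarMatrix n n B) := by
  classical
  let i₀ : n := Classical.arbitrary n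
  let N : CStarMatrix n n B := CStarMatrix.ofMatrix (Matrix.of fun i j => if i = i₀ then v j else 0)
  convert star_mul_self_nonneg N using 1
  ext i j
  simp [N, CStarMatrix.mul_apply, CStarMatrix.star_apply, apply_ite star]

theorem diag_nonneg_of_cstarMatrix_nonneg {M : CStarMatrix n n B} (hM : 0 ≤ M) (i : n) :
    0 ≤ M i i := by
  classical
  obtain ⟨N, rfl⟩ := exists_eq_star_mul_self_of_nonneg hM
  rw [CStarMatrix.mul_apply]
  exact Finset.sum_nonneg fun j _ => by
    rw [CStarMatrix.star_apply]
    exact star_mul_self_nonneg _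

variable {H : Type*} [NormedAddCommGroup H] [InnerProductSpace ℂ H] [CompleteSpace H]

theorem cstarMatrix_nonneg_iff {M : CStarMatrix n n (H →L[ℂ] H)} :
    0 ≤ M ↔ ∀ ξ : n → H, 0 ≤ ∑ i, ∑ j, ⟪ξ i, M i j (ξ j)⟫_ℂ := by
  classical
  rw [← map_nonneg_iff_of_injective (B := CStarMatrix n n (H →L[ℂ] H)) _ matrixAction_injective,
    nonneg_iff_forall_inner_nonneg]
  simp only [inner_matrixAction_apply]
  exact (WithLp.equiv 2 (n → H)).forall_congr_left

theorem norm_inner_sq_le_of_cstarMatrix_nonneg {M : CStarMatrix n n (H →L[ℂ] H)} (hM : 0 ≤ M)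
    (i j : n) (ξ ζ : H) :
    ‖⟪ξ, M i j ζ⟫_ℂ‖ ^ 2 ≤ (⟪ξ, M i i ξ⟫_ℂ).re * (⟪ζ, M j j ζ⟫_ℂ).re := by
  classical
  obtain ⟨N, rfl⟩ := exists_eq_star_mul_self_of_nonneg hM
  let S (i : n) (ξ : H) := matrixAction n H N (PiLp.single (β := fun _ : n => H) 2 i ξ)
  have entry (i j : n) (ξ ζ : H) : ⟪ξ, (star N * N) i j ζ⟫_ℂ = ⟪S i ξ, S j ζ⟫_ℂ := by
    rw [← inner_single_matrixAction_single, map_mul, map_star, mul_apply_eq_comp,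
      ContinuousLinearMap.star_eq_adjoint, ContinuousLinearMap.adjoint_inner_right]
  simp only [entry, ← RCLike.re_eq_complex_re, inner_self_eq_norm_sq, ← mul_pow]
  gcongr
  exact norm_inner_le_norm _ _

end CStarMatrix

section Order

variable {A : Type*} [CStarAlgebra A] [PartialOrder A]
variable {H : Type*} [NormedAddCommGroup H] [InnerProductSpace ℂ H]
variable {φ ψ χ : A →ₗ[ℂ] (H →L[ℂ] H)}

theorem majorizes_add_left (hφ : IsPositive φ) : Majorizes (φ + ψ) ψ := by
  rwa [Majorizes, add_sub_cancel_right]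

theorem majorizes_add_right (hψ : IsPositive ψ) : Majorizes (φ + ψ) φ := by
  rwa [Majorizes, add_sub_cancel_left]

theorem IsPositive.re_inner_nonneg (hφ : IsPositive φ) {a : A} (ha : 0 ≤ a) (ξ : H) :
    0 ≤ (⟪ξ, φ a ξ⟫_ℂ).re :=
  (Complex.nonneg_iff.1 (nonneg_iff_forall_inner_nonneg.1 (hφ a ha) ξ)).1

variable [CompleteSpace H]

theorem IsPositive.add (hφ : IsPositive φ) (hψ : IsPositive ψ) : IsPositive (φ + ψ) :=
  fun a ha => add_nonneg (hφ a ha) (hψ a ha)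

theorem Majorizes.trans (h₁ : Majorizes φ ψ) (h₂ : Majorizes ψ χ) : Majorizes φ χ := by
  rw [Majorizes, ← sub_add_sub_cancel φ ψ χ]
  exact IsPositive.add h₁ h₂

end Order

section Positivity

variable {A : Type*} [CStarAlgebra A] [PartialOrder A] [StarOrderedRing A]
variable {H : Type*} [NormedAddCommGroup H] [InnerProductSpace ℂ H] [CompleteSpace H]
variable {φ ψ : A →ₗ[ℂ] (H →L[ℂ] H)}

theorem IsPositive.eq_zero_of_apply_one (hφ : IsPositive φ) (h1 : φ 1 = 0) : φ = 0 := by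
  have hnonneg : ∀ a, 0 ≤ a → φ a = 0 := fun a ha => by
    refine le_antisymm ?_ (hφ a ha)
    have h := hφ _ (sub_nonneg.2 (IsSelfAdjoint.of_nonneg ha).le_algebraMap_norm_self)
    rwa [map_sub, Algebra.algebraMap_eq_smul_one, ← Complex.coe_smul, map_smul, h1, smul_zero,
      zero_sub, neg_nonneg] at h
  exact LinearMap.ext_on (CStarAlgebra.span_nonneg (A := A)) hnonneg

theorem IsKPositive.isPositive {k : ℕ} [NeZero k] (hφ : IsKPositive k φ) : IsPositive φ := by
  intro a ha
  obtain ⟨b, rfl⟩ := exists_eq_star_mul_self_of_nonneg ha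
  exact diag_nonneg_of_cstarMatrix_nonneg
    (hφ _ (cstarMatrix_star_mul_nonneg fun _ : Fin k => b)) 0

theorem IsCompletelyPositive.isPositive (hφ : IsCompletelyPositive φ) : IsPositive φ :=
  (hφ 1).isPositive

theorem IsCompletelyPositive.add (hφ : IsCompletelyPositive φ) (hψ : IsCompletelyPositive ψ) :
    IsCompletelyPositive (φ + ψ) :=
  fun k M hM => add_nonneg (hφ k M hM) (hψ k M hM)

theorem isCompletelyPositive_zero : IsCompletelyPositive (0 : A →ₗ[ℂ] (H →L[ℂ] H)) :=
  fun _ _ _ => le_rfl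

theorem IsKPositive.norm_inner_sq_le (hφ : IsKPositive 2 φ) (a b : A) (ξ η : H) :
    ‖⟪ξ, φ (star a * b) η⟫_ℂ‖ ^ 2 ≤
      (⟪ξ, φ (star a * a) ξ⟫_ℂ).re * (⟪η, φ (star b * b) η⟫_ℂ).re :=
  norm_inner_sq_le_of_cstarMatrix_nonneg (hφ _ (cstarMatrix_star_mul_nonneg ![a, b])) 0 1 ξ η

theorem le_of_sq_le_mul {s t : ℝ} (hs : 0 ≤ s) (h : t ^ 2 ≤ s * t) : t ≤ s := by
  by_contra! hst
  nlinarith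

theorem IsKPositive.norm_apply_sq_le (hφ : IsKPositive 2 φ) (c : A) (η : H) :
    ‖φ c η‖ ^ 2 ≤ ‖φ 1‖ * (⟪η, φ (star c * c) η⟫_ℂ).re := by
  set x := φ c η
  have hc : 0 ≤ (⟪η, φ (star c * c) η⟫_ℂ).re :=
    hφ.isPositive.re_inner_nonneg (star_mul_self_nonneg c) η
  have hx : (⟪x, φ 1 x⟫_ℂ).re ≤ ‖φ 1‖ * ‖x‖ ^ 2 :=
    calc (⟪x, φ 1 x⟫_ℂ).re ≤ ‖x‖ * ‖φ 1 x‖ := re_inner_le_norm (𝕜 := ℂ) x (φ 1 x)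
      _ ≤ ‖x‖ * (‖φ 1‖ * ‖x‖) := by gcongr; exact (φ 1).le_opNorm x
      _ = ‖φ 1‖ * ‖x‖ ^ 2 := by ring
  refine le_of_sq_le_mul (by positivity) ?_
  calc (‖x‖ ^ 2) ^ 2 = ‖⟪x, x⟫_ℂ‖ ^ 2 := by simp [inner_self_eq_norm_sq_to_K]
    _ ≤ (⟪x, φ 1 x⟫_ℂ).re * (⟪η, φ (star c * c) η⟫_ℂ).re := by
        simpa only [star_one, one_mul] using hφ.norm_inner_sq_le 1 c x η
    _ ≤ ‖φ 1‖ * ‖x‖ ^ 2 * (⟪η, φ (star c * c) η⟫_ℂ).re := by gcongr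
    _ = ‖φ 1‖ * (⟪η, φ (star c * c) η⟫_ℂ).re * ‖x‖ ^ 2 := by ring

end Positivity

section Stinespring

variable {A : Type*} [CStarAlgebra A] [PartialOrder A] [StarOrderedRing A]
variable {H K : Type*} [NormedAddCommGroup H] [InnerProductSpace ℂ H] [CompleteSpace H]
  [NormedAddCommGroup K] [InnerProductSpace ℂ K] [CompleteSpace K]

/-- The map `a ↦ W π(a) W*` given by a representation `π` of `A` on `K` and an operator
`W : K → H`. -/
noncomputable def stinespringMap (π : A →⋆ₐ[ℂ] (K →L[ℂ] K)) (W : K →L[ℂ] H) :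
    A →ₗ[ℂ] (H →L[ℂ] H) where
  toFun a := W ∘L π a ∘L W.adjoint
  map_add' a b := by simp [ContinuousLinearMap.add_comp, ContinuousLinearMap.comp_add]
  map_smul' c a := by simp

theorem inner_stinespringMap_apply (π : A →⋆ₐ[ℂ] (K →L[ℂ] K)) (W : K →L[ℂ] H) (a : A) (ξ ζ : H) :
    ⟪ξ, stinespringMap π W a ζ⟫_ℂ = ⟪W.adjoint ξ, π a (W.adjoint ζ)⟫_ℂ :=
  (W.adjoint_inner_left _ ξ).symm

theorem inner_stinespringMap_star_mul_self (π : A →⋆ₐ[ℂ] (K →L[ℂ] K)) (W : K →L[ℂ] H) (a : A)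
    (ξ : H) : ⟪ξ, stinespringMap π W (star a * a) ξ⟫_ℂ = (‖π a (W.adjoint ξ)‖ ^ 2 : ℝ) := by
  rw [inner_stinespringMap_apply, map_mul, map_star, mul_apply_eq_comp,
    ContinuousLinearMap.star_eq_adjoint, ContinuousLinearMap.adjoint_inner_right,
    inner_self_eq_norm_sq_to_K]
  norm_cast

theorem stinespringMap_apply_one (π : A →⋆ₐ[ℂ] (K →L[ℂ] K)) (W : K →L[ℂ] H) :
    stinespringMap π W 1 = W ∘L W.adjoint := by
  ext ξ
  simp [stinespringMap]

theorem isCompletelyPositive_stinespringMap (π : A →⋆ₐ[ℂ] (K →L[ℂ] K)) (W : K →L[ℂ] H) :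
    IsCompletelyPositive (stinespringMap π W) := by
  intro k M hM
  have hπM : 0 ≤ M.map π := CompletelyPositiveMapClass.map_cstarMatrix_nonneg' π k M hM
  refine cstarMatrix_nonneg_iff.2 fun ξ => ?_
  simp only [CStarMatrix.map_apply, inner_stinespringMap_apply]
  exact cstarMatrix_nonneg_iff.1 hπM fun i => W.adjoint (ξ i)

end Stinespring

section GNS

variable {A : Type*} [CStarAlgebra A] [PartialOrder A] [StarOrderedRing A]
variable {H : Type*} [NormedAddCommGroup H] [InnerProductSpace ℂ H]
variable {φ : A →ₗ[ℂ] (H →L[ℂ] H)}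

/-- The positive functional `a ↦ ⟪η, φ a η⟫` of a positive map `φ` and a vector `η`. -/
noncomputable def vectorFunctional (hφ : IsPositive φ) (η : H) : A →ₚ[ℂ] ℂ :=
  .mk₀ ((innerSL ℂ η).toLinearMap ∘ₗ (ContinuousLinearMap.apply ℂ H η).toLinearMap ∘ₗ φ)
    fun a ha => nonneg_iff_forall_inner_nonneg.1 (hφ a ha) η

theorem norm_preGNS_sq (hφ : IsPositive φ) (η : H) (c : (vectorFunctional hφ η).PreGNS) :
    ‖c‖ ^ 2 = (⟪η, φ (star ((vectorFunctional hφ η).ofPreGNS c) *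
      (vectorFunctional hφ η).ofPreGNS c) η⟫_ℂ).re :=
  mod_cast congr_arg Complex.re ((vectorFunctional hφ η).preGNS_norm_sq c)

theorem gnsStarAlgHom_coe (f : A →ₚ[ℂ] ℂ) (a : A) (c : f.PreGNS) :
    f.gnsStarAlgHom a c = ↑(f.leftMulMapPreGNS a c) :=
  f.gnsNonUnitalStarAlgHom_apply_coe

variable [CompleteSpace H]

/-- The operator `c ↦ φ(c)η` on the pre-GNS space of `a ↦ ⟪η, φ(a)η⟫`, which is bounded when `φ` is
`2`-positive. -/
noncomputable def preGNSToHilbert (hφ : IsKPositive 2 φ) (η : H) :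
    (vectorFunctional hφ.isPositive η).PreGNS →L[ℂ] H :=
  ((ContinuousLinearMap.apply ℂ H η).toLinearMap ∘ₗ φ ∘ₗ
    (vectorFunctional hφ.isPositive η).ofPreGNS.toLinearMap).mkContinuous √‖φ 1‖ fun c => by
      rw [← sq_le_sq₀ (by positivity) (by positivity), mul_pow, Real.sq_sqrt (norm_nonneg _),
        norm_preGNS_sq]
      exact hφ.norm_apply_sq_le _ _

/-- The extension of `preGNSToHilbert` to the GNS Hilbert space. -/
noncomputable def gnsToHilbert (hφ : IsKPositive 2 φ) (η : H) :
    (vectorFunctional hφ.isPositive η).GNS →L[ℂ] H :=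
  (preGNSToHilbert hφ η).extend UniformSpace.Completion.toComplL

theorem gnsToHilbert_coe (hφ : IsKPositive 2 φ) (η : H)
    (c : (vectorFunctional hφ.isPositive η).PreGNS) :
    gnsToHilbert hφ η c = φ ((vectorFunctional hφ.isPositive η).ofPreGNS c) η :=
  ContinuousLinearMap.extend_eq (e := UniformSpace.Completion.toComplL) _
    UniformSpace.Completion.denseRange_coe (UniformSpace.Completion.isUniformInducing_coe _) c

/-- The completely positive map `a ↦ W π(a) W*`, where `π` is the GNS representation of
`a ↦ ⟪η, φ(a)η⟫` and `W` is `gnsToHilbert`. It lies below `φ` and detects `φ(1)η`. -/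
noncomputable def gnsCompression (hφ : IsKPositive 2 φ) (η : H) : A →ₗ[ℂ] (H →L[ℂ] H) :=
  stinespringMap (vectorFunctional hφ.isPositive η).gnsStarAlgHom (gnsToHilbert hφ η)

theorem norm_inner_gnsToHilbert_sq_le (hφ : IsKPositive 2 φ) (η ξ : H) (y : A)
    (c : (vectorFunctional hφ.isPositive η).GNS) :
    ‖⟪ξ, gnsToHilbert hφ η
        ((vectorFunctional hφ.isPositive η).gnsStarAlgHom (star y) c)⟫_ℂ‖ ^ 2 ≤
      (⟪ξ, φ (star y * y) ξ⟫_ℂ).re * ‖c‖ ^ 2 := by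
  induction c using UniformSpace.Completion.induction_on with
  | hp => exact isClosed_le (by fun_prop) (by fun_prop)
  | ih c =>
    rw [UniformSpace.Completion.norm_coe, norm_preGNS_sq, gnsStarAlgHom_coe, gnsToHilbert_coe]
    exact hφ.norm_inner_sq_le y _ ξ η

theorem norm_gnsStarAlgHom_adjoint_gnsToHilbert_sq_le (hφ : IsKPositive 2 φ) (η ξ : H) (y : A) :
    ‖(vectorFunctional hφ.isPositive η).gnsStarAlgHom y ((gnsToHilbert hφ η).adjoint ξ)‖ ^ 2 ≤
      (⟪ξ, φ (star y * y) ξ⟫_ℂ).re := by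
  set π := (vectorFunctional hφ.isPositive η).gnsStarAlgHom
  set W := gnsToHilbert hφ η
  set c := π y (W.adjoint ξ)
  have hc : ⟪ξ, W (π (star y) c)⟫_ℂ = (‖c‖ ^ 2 : ℝ) := by
    rw [← W.adjoint_inner_left, map_star, ContinuousLinearMap.star_eq_adjoint,
      ContinuousLinearMap.adjoint_inner_right, inner_self_eq_norm_sq_to_K]
    norm_cast
  refine le_of_sq_le_mul (hφ.isPositive.re_inner_nonneg (star_mul_self_nonneg y) ξ) ?_
  have h := norm_inner_gnsToHilbert_sq_le hφ η ξ y c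
  rwa [hc, Complex.norm_real, Real.norm_of_nonneg (sq_nonneg _)] at h

theorem majorizes_gnsCompression (hφ : IsKPositive 2 φ) (η : H) :
    Majorizes φ (gnsCompression hφ η) := by
  intro a ha
  obtain ⟨y, rfl⟩ := exists_eq_star_mul_self_of_nonneg ha
  refine nonneg_iff_forall_inner_nonneg.2 fun ξ => ?_
  have hφξ := nonneg_iff_forall_inner_nonneg.1 (hφ.isPositive _ ha) ξ
  rw [LinearMap.sub_apply, sub_apply, inner_sub_right, sub_nonneg, gnsCompression,
    inner_stinespringMap_star_mul_self]
  exact Complex.le_def.2 ⟨norm_gnsStarAlgHom_adjoint_gnsToHilbert_sq_le hφ η ξ y,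
    (Complex.nonneg_iff.1 hφξ).2⟩

theorem gnsCompression_ne_zero (hφ : IsKPositive 2 φ) {η : H} (hη : φ 1 η ≠ 0) :
    gnsCompression hφ η ≠ 0 := by
  intro h
  have hW : gnsToHilbert hφ η = 0 := by
    have h1 : gnsToHilbert hφ η ∘L (gnsToHilbert hφ η).adjoint = 0 := by
      rw [← stinespringMap_apply_one (vectorFunctional hφ.isPositive η).gnsStarAlgHom]
      exact congr($h 1)
    have h2 := (gnsToHilbert hφ η).ker_self_comp_adjoint
    rw [h1, ContinuousLinearMap.toLinearMap_zero, LinearMap.ker_zero, eq_comm,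
      LinearMap.ker_eq_top] at h2
    exact ContinuousLinearMap.adjoint.map_eq_zero_iff.1 (ContinuousLinearMap.coe_injective h2)
  have h1 := gnsToHilbert_coe hφ η ((vectorFunctional hφ.isPositive η).toPreGNS 1)
  rw [hW] at h1
  exact hη h1.symm

theorem IsKPositive.exists_isCompletelyPositive_le (hφ : IsKPositive 2 φ) (hφ0 : φ ≠ 0) :
    ∃ ψ : A →ₗ[ℂ] (H →L[ℂ] H), IsCompletelyPositive ψ ∧ Majorizes φ ψ ∧ ψ ≠ 0 := by
  obtain ⟨η, hη⟩ : ∃ η, φ 1 η ≠ 0 := by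
    by_contra! h
    exact hφ0 (hφ.isPositive.eq_zero_of_apply_one (ContinuousLinearMap.ext h))
  exact ⟨gnsCompression hφ η, isCompletelyPositive_stinespringMap _ _,
    majorizes_gnsCompression hφ η, gnsCompression_ne_zero hφ hη⟩

end GNS

section Transpose

variable {A : Type*} [CStarAlgebra A] [PartialOrder A]
variable {H : Type*} [NormedAddCommGroup H] [InnerProductSpace ℂ H]
variable {ι : Type*} [Fintype ι] [DecidableEq ι]

theorem nonneg_iff_posSemidef_toMatrix (b : OrthonormalBasis ι ℂ H) {x : H →L[ℂ] H} :
    0 ≤ x ↔ (LinearMap.toMatrix b.toBasis b.toBasis (x : H →ₗ[ℂ] H)).PosSemidef := by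
  rw [ContinuousLinearMap.nonneg_iff_isPositive, ← ContinuousLinearMap.isPositive_toLinearMap_iff,
    LinearMap.posSemidef_toMatrix_iff b]

variable [FiniteDimensional ℂ H]

theorem toMatrix_transposeMap (b : OrthonormalBasis ι ℂ H) (x : H →L[ℂ] H) :
    LinearMap.toMatrix b.toBasis b.toBasis (transposeMap b x : H →ₗ[ℂ] H) =
      (LinearMap.toMatrix b.toBasis b.toBasis (x : H →ₗ[ℂ] H)).transpose := by
  simp [transposeMap]

theorem transposeMap_transposeMap (b : OrthonormalBasis ι ℂ H) (x : H →L[ℂ] H) :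
    transposeMap b (transposeMap b x) = x := by
  refine ContinuousLinearMap.coe_injective
    ((LinearMap.toMatrix b.toBasis b.toBasis).injective ?_)
  rw [toMatrix_transposeMap, toMatrix_transposeMap, Matrix.transpose_transpose]

theorem transposeMap_comp_transposeMap_comp {V : Type*} [AddCommMonoid V] [Module ℂ V]
    (b : OrthonormalBasis ι ℂ H) (f : V →ₗ[ℂ] (H →L[ℂ] H)) :
    transposeMap b ∘ₗ transposeMap b ∘ₗ f = f :=
  LinearMap.ext fun v => transposeMap_transposeMap b (f v)

theorem transposeMap_nonneg (b : OrthonormalBasis ι ℂ H) {x : H →L[ℂ] H} (hx : 0 ≤ x) :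
    0 ≤ transposeMap b x := by
  rw [nonneg_iff_posSemidef_toMatrix b] at hx ⊢
  rw [toMatrix_transposeMap]
  exact hx.transpose

variable {b : OrthonormalBasis ι ℂ H} {φ ψ : A →ₗ[ℂ] (H →L[ℂ] H)}

theorem IsPositive.transposeMap_comp (hφ : IsPositive φ) (b : OrthonormalBasis ι ℂ H) :
    IsPositive (transposeMap b ∘ₗ φ) :=
  fun a ha => transposeMap_nonneg b (hφ a ha)

variable [StarOrderedRing A] [CompleteSpace H]

theorem IsKCopositive.isPositive {k : ℕ} [NeZero k] (hφ : IsKCopositive b k φ) :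
    IsPositive φ := by
  rw [← transposeMap_comp_transposeMap_comp b φ]
  exact (IsKPositive.isPositive hφ).transposeMap_comp b

theorem IsCopositive.isPositive (hφ : IsCopositive b φ) : IsPositive φ :=
  IsKCopositive.isPositive (hφ 1 : IsKCopositive b 1 φ)

theorem IsCopositive.add (hφ : IsCopositive b φ) (hψ : IsCopositive b ψ) :
    IsCopositive b (φ + ψ) := by
  rw [IsCopositive, LinearMap.comp_add]
  exact IsCompletelyPositive.add hφ hψ

theorem isCopositive_zero (b : OrthonormalBasis ι ℂ H) :
    IsCopositive b (0 : A →ₗ[ℂ] (H →L[ℂ] H)) := by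
  rw [IsCopositive, LinearMap.comp_zero]
  exact isCompletelyPositive_zero

theorem IsKCopositive.exists_isCopositive_le (hφ : IsKCopositive b 2 φ) (hφ0 : φ ≠ 0) :
    ∃ ψ : A →ₗ[ℂ] (H →L[ℂ] H), IsCopositive b ψ ∧ Majorizes φ ψ ∧ ψ ≠ 0 := by
  obtain ⟨ψ, hψ, hle, hψ0⟩ := IsKPositive.exists_isCompletelyPositive_le hφ fun h => hφ0 <| by
    rw [← transposeMap_comp_transposeMap_comp b φ, h, LinearMap.comp_zero]
  refine ⟨transposeMap b ∘ₗ ψ, ?_, ?_, fun h => hψ0 ?_⟩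
  · rwa [IsCopositive, transposeMap_comp_transposeMap_comp]
  · have h := hle.transposeMap_comp b
    rwa [LinearMap.comp_sub, transposeMap_comp_transposeMap_comp] at h
  · rw [← transposeMap_comp_transposeMap_comp b ψ, h, LinearMap.comp_zero]

end Transpose

section Decomposable

variable {A : Type*} [CStarAlgebra A] [PartialOrder A] [StarOrderedRing A]
variable {H : Type*} [NormedAddCommGroup H] [InnerProductSpace ℂ H] [FiniteDimensional ℂ H]
  [CompleteSpace H]
variable {ι : Type*} [Fintype ι] [DecidableEq ι] {b : OrthonormalBasis ι ℂ H}
variable {φ ψ α β : A →ₗ[ℂ] (H →L[ℂ] H)}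

theorem IsBioptimal.isAtomic (hβ : IsBioptimal b β) (hβ0 : β ≠ 0) : IsAtomic b β := by
  rintro ⟨φ₁, φ₂, h₁, h₂, rfl⟩
  rcases eq_or_ne φ₁ 0 with rfl | h0
  · rw [zero_add] at hβ hβ0
    obtain ⟨ψ, hψ, hle, hψ0⟩ := h₂.exists_isCopositive_le hβ0
    exact hψ0 (hβ.2 ψ hψ hle)
  · obtain ⟨ψ, hψ, hle, hψ0⟩ := h₁.exists_isCompletelyPositive_le h0
    exact hψ0 (hβ.1 ψ hψ ((majorizes_add_right h₂.isPositive).trans hle))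

theorem IsMaximalDecomposable.eq_zero_of_isDecomposable_add (hα : IsMaximalDecomposable b φ α)
    (hψ : IsPositive ψ) (hle : Majorizes (φ - α) ψ) (hαψ : IsDecomposable b (α + ψ)) : ψ = 0 := by
  by_contra hψ0
  refine hα.2.2 ⟨α + ψ, hαψ, by simpa using hψ0, majorizes_add_right hψ, ?_⟩
  rwa [Majorizes, ← sub_sub]

theorem IsMaximalDecomposable.isBioptimal (hα : IsMaximalDecomposable b φ α) :
    IsBioptimal b (φ - α) := by
  obtain ⟨α₁, α₂, h₁, h₂, rfl⟩ := hα.1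
  exact ⟨fun ψ hψ hle => hα.eq_zero_of_isDecomposable_add hψ.isPositive hle
      ⟨α₁ + ψ, α₂, h₁.add hψ, h₂, add_right_comm α₁ α₂ ψ⟩,
    fun ψ hψ hle => hα.eq_zero_of_isDecomposable_add hψ.isPositive hle
      ⟨α₁, α₂ + ψ, h₁, h₂.add hψ, add_assoc α₁ α₂ ψ⟩⟩

end Decomposable

section Trace

variable {H : Type*} [NormedAddCommGroup H] [InnerProductSpace ℂ H]

theorem trace_nonneg_of_nonneg {T : H →L[ℂ] H} (hT : 0 ≤ T) : 0 ≤ LinearMap.trace ℂ H T :=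
  (((ContinuousLinearMap.nonneg_iff_isPositive T).1 hT).toLinearMap).trace_nonneg

variable [FiniteDimensional ℂ H]

theorem eq_zero_of_nonneg_of_trace_eq_zero {T : H →L[ℂ] H} (hT : 0 ≤ T)
    (htr : LinearMap.trace ℂ H T = 0) : T = 0 := by
  let b := stdOrthonormalBasis ℂ H
  rw [nonneg_iff_posSemidef_toMatrix b] at hT
  rw [LinearMap.trace_eq_matrix_trace ℂ b.toBasis, hT.trace_eq_zero_iff] at htr
  exact ContinuousLinearMap.coe_injective
    ((LinearMap.toMatrix b.toBasis b.toBasis).map_eq_zero_iff.1 htr)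

variable {A : Type*} [CStarAlgebra A] [PartialOrder A] [StarOrderedRing A] [CompleteSpace H]

theorem Majorizes.eq_of_trace_apply_one_le {φ ψ : A →ₗ[ℂ] (H →L[ℂ] H)} (hle : Majorizes φ ψ)
    (htr : (LinearMap.trace ℂ H (φ 1)).re ≤ (LinearMap.trace ℂ H (ψ 1)).re) : φ = ψ := by
  have h1 : 0 ≤ (φ - ψ) 1 := hle 1 zero_le_one
  have htr_nonneg := trace_nonneg_of_nonneg h1
  have htr_nonpos : LinearMap.trace ℂ H ((φ - ψ) 1) ≤ 0 :=
    Complex.le_def.2 ⟨by simpa using htr, (Complex.nonneg_iff.1 htr_nonneg).2.symm⟩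
  exact sub_eq_zero.1 <| hle.eq_zero_of_apply_one <|
    eq_zero_of_nonneg_of_trace_eq_zero h1 (htr_nonpos.antisymm htr_nonneg)

end Trace

section PointwiseTopology

variable {R M N : Type*} [Semiring R] [AddCommMonoid M] [Module R M] [AddCommMonoid N] [Module R N]
  [TopologicalSpace N]

/-- The topology of pointwise convergence on linear maps, in which the positive maps below a given
map form a compact set. -/
abbrev pointwiseTopology : TopologicalSpace (M →ₗ[R] N) :=
  .induced DFunLike.coe inferInstance

attribute [local instance] pointwiseTopology

theorem continuous_linearMap_apply (x : M) : Continuous fun f : M →ₗ[R] N => f x :=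
  (continuous_apply x).comp continuous_induced_dom

theorem continuousAdd_linearMap [ContinuousAdd N] : ContinuousAdd (M →ₗ[R] N) :=
  continuousAdd_induced (LinearMap.ltoFun R M N ℕ)

theorem isClosedEmbedding_linearMap_coe [ContinuousAdd N] [ContinuousConstSMul R N] [T2Space N] :
    Topology.IsClosedEmbedding (DFunLike.coe : (M →ₗ[R] N) → M → N) :=
  ⟨⟨⟨rfl⟩, DFunLike.coe_injective⟩, LinearMap.isClosed_range_coe M N (RingHom.id R)⟩

end PointwiseTopology

section Compactness

attribute [local instance] pointwiseTopology

variable {A : Type*} [CStarAlgebra A] [PartialOrder A]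
variable {H : Type*} [NormedAddCommGroup H] [InnerProductSpace ℂ H] [CompleteSpace H]

theorem isClosed_setOfPred_isPositive : IsClosed {ψ : A →ₗ[ℂ] (H →L[ℂ] H) | IsPositive ψ} := by
  simp only [IsPositive, Set.ofPred_forall]
  exact isClosed_iInter fun a => isClosed_iInter fun _ =>
    isClosed_Ici.preimage (continuous_linearMap_apply a)

theorem isClosed_setOfPred_majorizes (φ : A →ₗ[ℂ] (H →L[ℂ] H)) :
    IsClosed {ψ : A →ₗ[ℂ] (H →L[ℂ] H) | Majorizes φ ψ} := by
  simp only [Majorizes, IsPositive, LinearMap.sub_apply, sub_nonneg, Set.ofPred_forall]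
  exact isClosed_iInter fun a => isClosed_iInter fun _ =>
    isClosed_Iic.preimage (continuous_linearMap_apply a)

variable [StarOrderedRing A]

theorem isClosed_setOfPred_isCompletelyPositive :
    IsClosed {ψ : A →ₗ[ℂ] (H →L[ℂ] H) | IsCompletelyPositive ψ} := by
  simp only [IsCompletelyPositive, IsKPositive, Set.ofPred_forall]
  refine isClosed_iInter fun k => isClosed_iInter fun M => isClosed_iInter fun _ => ?_
  refine isClosed_Ici.preimage (f := fun ψ : A →ₗ[ℂ] (H →L[ℂ] H) => M.map ψ) ?_
  exact continuous_pi fun i => continuous_pi fun j => continuous_linearMap_apply (M i j)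

theorem exists_norm_apply_le_of_majorizes (φ : A →ₗ[ℂ] (H →L[ℂ] H)) (a : A) :
    ∃ C, ∀ ψ : A →ₗ[ℂ] (H →L[ℂ] H), IsPositive ψ → Majorizes φ ψ → ‖ψ a‖ ≤ C := by
  obtain ⟨x, hx, -, rfl⟩ := CStarAlgebra.exists_sum_four_nonneg a
  refine ⟨∑ i, ‖φ (x i)‖, fun ψ hψ hle => ?_⟩
  have hi (i : Fin 4) : ‖ψ (Complex.I ^ (i : ℕ) • x i)‖ ≤ ‖φ (x i)‖ := by
    rw [map_smul, norm_smul, norm_pow, Complex.norm_I, one_pow, one_mul]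
    exact CStarAlgebra.norm_le_norm_of_nonneg_of_le (hψ _ (hx i)) (sub_nonneg.1 (hle _ (hx i)))
  rw [map_sum]
  exact norm_sum_le_of_le _ fun i _ => hi i

variable [FiniteDimensional ℂ H]

theorem isCompact_setOfPred_isPositive_majorizes (φ : A →ₗ[ℂ] (H →L[ℂ] H)) :
    IsCompact {ψ : A →ₗ[ℂ] (H →L[ℂ] H) | IsPositive ψ ∧ Majorizes φ ψ} := by
  choose C hC using exists_norm_apply_le_of_majorizes φ
  have : ProperSpace (H →L[ℂ] H) := FiniteDimensional.proper ℂ _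
  have hball : IsCompact (Set.univ.pi fun a : A => Metric.closedBall (0 : H →L[ℂ] H) (C a)) :=
    isCompact_univ_pi fun a => isCompact_closedBall 0 (C a)
  refine (isClosedEmbedding_linearMap_coe.isCompact_preimage hball).of_isClosed_subset
    (isClosed_setOfPred_isPositive.inter (isClosed_setOfPred_majorizes φ)) fun ψ hψ a _ => ?_
  exact mem_closedBall_zero_iff.2 (hC a ψ hψ.1 hψ.2)

variable {ι : Type*} [Fintype ι] [DecidableEq ι]

theorem isClosed_setOfPred_isCopositive (b : OrthonormalBasis ι ℂ H) :
    IsClosed {ψ : A →ₗ[ℂ] (H →L[ℂ] H) | IsCopositive b ψ} := by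
  refine isClosed_setOfPred_isCompletelyPositive.preimage
    (f := fun ψ : A →ₗ[ℂ] (H →L[ℂ] H) => transposeMap b ∘ₗ ψ) ?_
  exact continuous_induced_rng.2 <| continuous_pi fun a =>
    (transposeMap b).continuous_of_finiteDimensional.comp (continuous_linearMap_apply a)

theorem isCompact_setOfPred_isDecomposable_majorizes (b : OrthonormalBasis ι ℂ H)
    (φ : A →ₗ[ℂ] (H →L[ℂ] H)) :
    IsCompact {ψ : A →ₗ[ℂ] (H →L[ℂ] H) | IsDecomposable b ψ ∧ Majorizes φ ψ} := by
  let K := {ψ : A →ₗ[ℂ] (H →L[ℂ] H) | IsPositive ψ ∧ Majorizes φ ψ}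
  have hK : IsCompact K := isCompact_setOfPred_isPositive_majorizes φ
  have : ContinuousAdd (A →ₗ[ℂ] (H →L[ℂ] H)) := continuousAdd_linearMap
  have hsum := (hK.inter_right isClosed_setOfPred_isCompletelyPositive).add
    (hK.inter_right (isClosed_setOfPred_isCopositive b))
  convert hsum.inter_right (isClosed_setOfPred_majorizes φ) using 1
  ext ψ
  refine and_congr_left fun hψ => ⟨?_, ?_⟩
  · rintro ⟨ψ₁, ψ₂, h₁, h₂, rfl⟩
    have hle₁ : Majorizes φ ψ₁ := hψ.trans (majorizes_add_right h₂.isPositive)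
    have hle₂ : Majorizes φ ψ₂ := hψ.trans (majorizes_add_left h₁.isPositive)
    exact ⟨ψ₁, ⟨⟨h₁.isPositive, hle₁⟩, h₁⟩, ψ₂, ⟨⟨h₂.isPositive, hle₂⟩, h₂⟩, rfl⟩
  · rintro ⟨ψ₁, ⟨-, h₁⟩, ψ₂, ⟨-, h₂⟩, rfl⟩
    exact ⟨ψ₁, ψ₂, h₁, h₂, rfl⟩

theorem IsPositive.exists_isMaximalDecomposable {φ : A →ₗ[ℂ] (H →L[ℂ] H)} (hφ : IsPositive φ)
    (b : OrthonormalBasis ι ℂ H) : ∃ α, IsMaximalDecomposable b φ α := by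
  let traceOne (ψ : A →ₗ[ℂ] (H →L[ℂ] H)) : ℝ := (LinearMap.trace ℂ H (ψ 1)).re
  have htrace : Continuous traceOne := by
    have h := (LinearMap.trace ℂ H ∘ₗ ContinuousLinearMap.coeLM ℂ).continuous_of_finiteDimensional
    exact Complex.continuous_re.comp (h.comp (continuous_linearMap_apply (1 : A)))
  have hzero : (0 : A →ₗ[ℂ] (H →L[ℂ] H)) ∈ {ψ | IsDecomposable b ψ ∧ Majorizes φ ψ} :=
    ⟨⟨0, 0, isCompletelyPositive_zero, isCopositive_zero b, (add_zero 0).symm⟩,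
      by rwa [Majorizes, sub_zero]⟩
  obtain ⟨α, ⟨hα, hαφ⟩, hmax⟩ := (isCompact_setOfPred_isDecomposable_majorizes b φ).exists_isMaxOn
    ⟨0, hzero⟩ htrace.continuousOn
  refine ⟨α, hα, hαφ, ?_⟩
  rintro ⟨ψ, hψ, hne, hαψ, hψφ⟩
  exact hne (hαψ.eq_of_trace_apply_one_le (hmax ⟨hψ, hψφ⟩))

end Compactness

end PositiveMap

theorem theorem4_general {A : Type*} [CStarAlgebra A] [PartialOrder A] [StarOrderedRing A]
    {H : Type*} [NormedAddCommGroup H] [InnerProductSpace ℂ H] [CompleteSpace H]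
    [FiniteDimensional ℂ H]
    {ι : Type*} [Fintype ι] [DecidableEq ι] (b : OrthonormalBasis ι ℂ H)
    (φ : A →ₗ[ℂ] (H →L[ℂ] H)) (hφ : PositiveMap.IsPositive φ) :
    ∃ α β : A →ₗ[ℂ] (H →L[ℂ] H),
      PositiveMap.IsMaximalDecomposable b φ α ∧
      PositiveMap.IsPositive β ∧
      PositiveMap.IsBioptimal b β ∧
      (β ≠ 0 → PositiveMap.IsAtomic b β) ∧
      φ = α + β := by
  obtain ⟨α, hα⟩ := hφ.exists_isMaximalDecomposable b
  exact ⟨α, φ - α, hα, hα.2.1, hα.isBioptimal, hα.isBioptimal.isAtomic,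
    (add_sub_cancel α φ).symm⟩

theorem theorem4 {A : Type*} [CStarAlgebra A] [PartialOrder A] [StarOrderedRing A]
    [FiniteDimensional ℂ A]
    {H : Type*} [NormedAddCommGroup H] [InnerProductSpace ℂ H] [CompleteSpace H]
    [FiniteDimensional ℂ H]
    {ι : Type*} [Fintype ι] [DecidableEq ι] (b : OrthonormalBasis ι ℂ H)
    (φ : A →ₗ[ℂ] (H →L[ℂ] H)) (hφ : PositiveMap.IsPositive φ) :
    ∃ α β : A →ₗ[ℂ] (H →L[ℂ] H),
      PositiveMap.IsMaximalDecomposable b φ α ∧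
      PositiveMap.IsPositive β ∧
      PositiveMap.IsBioptimal b β ∧
      (β ≠ 0 → PositiveMap.IsAtomic b β) ∧
      φ = α + β :=
  theorem4_general b φ hφ
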